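/- Let $F:\mathbb R^n\to\mathbb R^n$ be Lipschitz, let $B$ be a real $n\times m$ matrix of rank $m$, let $\mathcal C\subset\mathbb R^n$ be a bounded convex set with non-empty interior $\mathcal C^{\mathrm o}$, and let $y^0,y^1\in\mathcal C^{\mathrm o}$. Put $H=(\operatorname{ran}B)^\perp$, let $P_H$ be the orthogonal projection onto $H$, $F_H=P_H\circ F$, and $h_i=P_Hy^i$ for $i=0,1$. Let $T_{\mathcal C}(y^0,y^1)\in[0,\infty]$ be the infimum of all $T>0$ for which there are a control $u\in L^\infty([0,T],\mathbb R^m)$ and an absolutely continuous $y:[0,T]\to\mathbb R^n$ with $\dot y(t)=F(y(t))+Bu(t)$ for almost every $t\in[0,T]$, $y(t)\in\mathcal C$ for all $t\in[0,T]$, $y(0)=y^0$ and $y(T)=y^1$. Let $\overline T_{\mathcal C}(y^0,y^1)\in[0,\infty]$ be the infimum of all $T\ge 0$ for which there is an absolutely continuous $z:[0,T]\to H$ with $\dot z(t)\in F_H\big((z(t)+H^\perp)\cap\mathcal C\big)$ for almost every $t\in[0,T]$, $z(0)=h_0$ and $z(T)=h_1$. In both cases $\inf\varnothing=\infty$. Assume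 that $\dim H=1$ and $h_0\ne h_1$. Let $[h_0,h_1]$ be the closed segment between $h_0$ and $h_1$, and for $h\in[h_0,h_1]$ set $$s(h,h_0,h_1)=\frac{\sup\{\langle x,h_1-h_0\rangle: x\in F_H((h+H^\perp)\cap\mathcal C)\}}{|h_1-h_0|}.$$ (i) If $s(h,h_0,h_1)>0$ for all $h\in[h_0,h_1]$, then $T_{\mathcal C}(y^0,y^1)=\overline T_{\mathcal C}(y^0,y^1)<\infty$, the function $1/s(\cdot,h_0,h_1)$ is integrable on $[h_0,h_1]$ with respect to arc length, and $$T_{\mathcal C}(y^0,y^1)=\int_{[h_0,h_1]}\frac{dh}{s(h,h_0,h_1)}=\int_0^{|h_1-h_0|}\frac{dv}{s\big(h_0+\tfrac{v}{|h_1-h_0|}(h_1-h_0),h_0,h_1\big)}.$$ (ii) If $s(h_2,h_0,h_1)\le 0$ for some $h_2\in[h_0,h_1]$, then $T_{\mathcal C}(y^0,y^1)=\overline T_{\mathcal C}(y^0,y^1)=\infty$. -/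

import Mathlib

open Set MeasureTheory
open scoped NNReal ENNReal

noncomputable section

namespace ControlTime

/-- The state space `ℝⁿ` with its Euclidean norm. -/
abbrev State (n : ℕ) : Type := EuclideanSpace ℝ (Fin n)

variable {n m : ℕ}

/-- The space of slow directions `H = (ran B)ᗮ`. -/
abbrev slowSpace (B : Matrix (Fin n) (Fin m) ℝ) : Submodule ℝ (State n) :=
  (LinearMap.range (Matrix.toEuclideanLin B))ᗮ

/-- The orthogonal projection `P_H : ℝⁿ → H`. -/
abbrev slowProj (B : Matrix (Fin n) (Fin m) ℝ) : State n →L[ℝ] slowSpace B :=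
  (slowSpace B).orthogonalProjectionOnto

/-- The projected drift `F_H = P_H ∘ F`. -/
def slowDrift (F : State n → State n) (B : Matrix (Fin n) (Fin m) ℝ) :
    State n → slowSpace B :=
  fun x => slowProj B (F x)

/-- The slice `(h + Hᗮ) ∩ C`. -/
def slice (B : Matrix (Fin n) (Fin m) ℝ) (C : Set (State n)) (h : slowSpace B) :
    Set (State n) :=
  {x | ∃ w ∈ (slowSpace B)ᗮ, x = (h : State n) + w} ∩ C

/-- The pair `(y, u)` solves `y' = F(y) + B u` on `[0, T]` (in the sense of Carathéodory, i.e. `y` is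
absolutely continuous and the equation holds for almost every `t`), with an `L^∞` control `u`
and under the state constraint `y(t) ∈ C` for all `t ∈ [0, T]`. -/
structure IsControlledTrajectory (F : State n → State n) (B : Matrix (Fin n) (Fin m) ℝ)
    (C : Set (State n)) (T : ℝ) (u : ℝ → State m) (y : ℝ → State n) : Prop where
  control : MemLp u ∞ (volume.restrict (Icc 0 T))
  absCont : AbsolutelyContinuousOnInterval y 0 T
  ode : ∀ᵐ t ∂(volume.restrict (Icc 0 T)),
    HasDerivAt y (F (y t) + Matrix.toEuclideanLin B (u t)) t
  constraint : ∀ t ∈ Icc 0 T, y t ∈ C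

/-- The controllability time `T_C(y⁰, y¹)`, with `inf ∅ = ∞`. -/
def controlTime (F : State n → State n) (B : Matrix (Fin n) (Fin m) ℝ) (C : Set (State n))
    (y0 y1 : State n) : ℝ≥0∞ :=
  sInf {τ | ∃ T : ℝ, 0 < T ∧ τ = ENNReal.ofReal T ∧
    ∃ (u : ℝ → State m) (y : ℝ → State n),
      IsControlledTrajectory F B C T u y ∧ y 0 = y0 ∧ y T = y1}

/-- The function `z` solves the differential inclusion `z' ∈ F_H((z + Hᗮ) ∩ C)` in `H` on `[0, T]`:
it is absolutely continuous and the inclusion holds for almost every `t`. -/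
structure IsInclusionTrajectory (F : State n → State n) (B : Matrix (Fin n) (Fin m) ℝ)
    (C : Set (State n)) (T : ℝ) (z : ℝ → slowSpace B) : Prop where
  absCont : AbsolutelyContinuousOnInterval z 0 T
  inclusion : ∀ᵐ t ∂(volume.restrict (Icc 0 T)),
    ∃ v ∈ slowDrift F B '' slice B C (z t), HasDerivAt z v t

/-- The auxiliary controllability time of the differential inclusion, with `inf ∅ = ∞`. -/
def auxControlTime (F : State n → State n) (B : Matrix (Fin n) (Fin m) ℝ) (C : Set (State n))
    (y0 y1 : State n) : ℝ≥0∞ :=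
  sInf {τ | ∃ T : ℝ, 0 ≤ T ∧ τ = ENNReal.ofReal T ∧
    ∃ z : ℝ → slowSpace B,
      IsInclusionTrajectory F B C T z ∧ z 0 = slowProj B y0 ∧ z T = slowProj B y1}

/-- The maximal speed
`s(h, h₀, h₁) = sup ⟨F_H((h + Hᗮ) ∩ C), h₁ - h₀⟩ / |h₁ - h₀|`. -/
def maxSpeed (F : State n → State n) (B : Matrix (Fin n) (Fin m) ℝ) (C : Set (State n))
    (h h0 h1 : slowSpace B) : ℝ :=
  sSup ((fun x : slowSpace B => inner ℝ x (h1 - h0)) '' (slowDrift F B '' slice B C h)) /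
    ‖h1 - h0‖

/-- The arc length parametrization `v ↦ h₀ + (v / |h₁ - h₀|) (h₁ - h₀)`, `0 ≤ v ≤ |h₁ - h₀|`,
of the segment `[h₀, h₁]`. -/
def arcPoint {V : Type*} [NormedAddCommGroup V] [NormedSpace ℝ V] (h0 h1 : V) (v : ℝ) : V :=
  h0 + (v / ‖h1 - h0‖) • (h1 - h0)

end ControlTime

end

/-! ### Lower bounds for the travel time of a scalar absolutely continuous function. -/

section Comparison

open Filter Topology

/-! Since `H` is a line spanned by the unit vector `e = (h1 - h0) / ‖h1 - h0‖`, motion in `H` is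
recorded by the height `⟪e, ·⟫`. It runs from `a = ⟪e, y0⟫` to `b = ⟪e, y1⟫`, and the control does
not act on it. Put `f = ⟪e, F ·⟫` and let `S v` be the supremum of `f` over the part of `C` at
height `v`; this is `maxSpeed`. Convexity makes `S` Lipschitz on `[a, b]`
(`exists_lipschitzOnWith_sliceSpeed`).

Lower bound: the height `ζ` of an inclusion trajectory satisfies `ζ' ≤ S(ζ)` almost everywhere. If
`S > 0`, a primitive of `1 / S` composed with `ζ` grows at rate at most one while `ζ` crosses `[a,
b]`, so `∫ 1 / S ≤ T`. If `S v ≤ 0` somewhere, the Lipschitz bound and Grönwall's argument show that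
`ζ` cannot pass `v` in finite time.

Upper bound: a Lipschitz curve in `C` whose height obeys `f` is produced by a bounded control,
because the control reaches all of `Hᗮ`. Such a curve can jump within a slice in arbitrarily short
time, then follow a line parallel to `e` where `f` is nearly maximal, then jump again. By
compactness finitely many such manoeuvres lead from `y0` to `y1` in time at most `∫ (1 / S + ε)`
(`exists_steerable_le_integral`).

Projecting controlled trajectories gives `auxControlTime ≤ controlTime`, which closes the chain of
inequalities. -/

theorem LipschitzOnWith.comp_absolutelyContinuousOnInterval {X Y : Type*} [PseudoMetricSpace X]
    [PseudoMetricSpace Y] {g : X → Y} {f : ℝ → X} {K : ℝ≥0} {a b : ℝ} {s : Set X}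
    (hg : LipschitzOnWith K g s) (hf : AbsolutelyContinuousOnInterval f a b)
    (hs : MapsTo f (uIcc a b) s) :
    AbsolutelyContinuousOnInterval (g ∘ f) a b := by
  rw [absolutelyContinuousOnInterval_iff] at hf ⊢
  intro ε hε
  obtain ⟨δ, hδ, h⟩ := hf (ε / (K + 1)) (by positivity)
  refine ⟨δ, hδ, fun E hE hlt => ?_⟩
  have hsum : ∑ i ∈ Finset.range E.1, dist ((g ∘ f) (E.2 i).1) ((g ∘ f) (E.2 i).2) ≤
      K * ∑ i ∈ Finset.range E.1, dist (f (E.2 i).1) (f (E.2 i).2) := by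
    rw [Finset.mul_sum]
    refine Finset.sum_le_sum fun i hi => ?_
    exact hg.dist_le_mul _ (hs (hE.1 i hi).1) _ (hs (hE.1 i hi).2)
  have h1 := h E hE hlt
  rw [lt_div_iff₀ (by positivity)] at h1
  have h2 : 0 ≤ ∑ i ∈ Finset.range E.1, dist (f (E.2 i).1) (f (E.2 i).2) :=
    Finset.sum_nonneg fun _ _ => dist_nonneg
  nlinarith

theorem AbsolutelyContinuousOnInterval.sub_le_of_ae_deriv_le {ψ : ℝ → ℝ} {s t c : ℝ}
    (hst : s ≤ t) (hψ : AbsolutelyContinuousOnInterval ψ s t)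
    (h : ∀ᵐ x, x ∈ Ioc s t → ∃ d ≤ c, HasDerivAt ψ d x) :
    ψ t - ψ s ≤ c * (t - s) := by
  rw [← hψ.integral_deriv_eq_sub]
  have h1 : ∫ x in s..t, deriv ψ x ≤ ∫ _ in s..t, c := by
    refine intervalIntegral.integral_mono_ae_restrict hst hψ.intervalIntegrable_deriv (by simp) ?_
    have h2 : ∀ᵐ x ∂(volume.restrict (Ioc s t)), deriv ψ x ≤ c := by
      rw [ae_restrict_iff' measurableSet_Ioc]
      filter_upwards [h] with x hx hxm
      obtain ⟨d, hd, hx⟩ := hx hxm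
      exact hx.deriv ▸ hd
    rw [restrict_Ioc_eq_restrict_Icc] at h2
    exact h2
  simpa [mul_comm] using h1

/-- Take for `t₁` the first time at height at least `b`, and for `t₀` the last time before it at
height at most `a`. By the intermediate value theorem, leaving `[a, b]` in between would contradict
one of these choices. -/
theorem ContinuousOn.exists_crossing {ζ : ℝ → ℝ} {T a b : ℝ} (hT : 0 ≤ T) (hab : a < b)
    (hζ : ContinuousOn ζ (Icc 0 T)) (h0 : ζ 0 ≤ a) (h1 : b ≤ ζ T) :
    ∃ t₀ t₁, 0 ≤ t₀ ∧ t₀ ≤ t₁ ∧ t₁ ≤ T ∧ ζ t₀ = a ∧ ζ t₁ = b ∧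
      ∀ t ∈ Icc t₀ t₁, ζ t ∈ Icc a b := by
  obtain ⟨t₁, ⟨ht₁, hb⟩, hmin⟩ := (isCompact_Icc.of_isClosed_subset
    (hζ.preimage_isClosed_of_isClosed isClosed_Icc isClosed_Ici) inter_subset_left).exists_isLeast
      (⟨T, ⟨hT, le_rfl⟩, h1⟩ : (Icc 0 T ∩ ζ ⁻¹' Ici b).Nonempty)
  have hζ' : ContinuousOn ζ (Icc 0 t₁) := hζ.mono (Icc_subset_Icc_right ht₁.2)
  obtain ⟨t₀, ⟨ht₀, ha⟩, hmax⟩ := (isCompact_Icc.of_isClosed_subset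
    (hζ'.preimage_isClosed_of_isClosed isClosed_Icc isClosed_Iic) inter_subset_left).exists_isGreatest
      (⟨0, ⟨le_rfl, ht₁.1⟩, h0⟩ : (Icc 0 t₁ ∩ ζ ⁻¹' Iic a).Nonempty)
  simp only [mem_preimage, mem_Ici, mem_Iic] at hb ha
  have hζ'' : ContinuousOn ζ (Icc t₀ t₁) := hζ'.mono (Icc_subset_Icc_left ht₀.1)
  have hbt : ∀ t ∈ Icc t₀ t₁, ζ t ≤ b := by
    intro t ht
    by_contra! hlt
    obtain ⟨x, hx, hxb⟩ := intermediate_value_Icc ht.1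
      (hζ''.mono (Icc_subset_Icc_right ht.2)) ⟨ha.trans hab.le, hlt.le⟩
    have : t₁ ≤ x := hmin ⟨⟨ht₀.1.trans hx.1, hx.2.trans (ht.2.trans ht₁.2)⟩, hxb.ge⟩
    have : x = t := le_antisymm hx.2 (ht.2.trans this)
    subst this; linarith
  have hat : ∀ t ∈ Icc t₀ t₁, a ≤ ζ t := by
    intro t ht
    by_contra! hlt
    obtain ⟨x, hx, hxa⟩ := intermediate_value_Icc ht.2
      (hζ''.mono (Icc_subset_Icc_left ht.1)) ⟨hlt.le, hab.le.trans hb⟩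
    have : x ≤ t₀ := hmax ⟨⟨ht₀.1.trans (ht.1.trans hx.1), hx.2⟩, hxa.le⟩
    have : x = t := le_antisymm (this.trans ht.1) hx.1
    subst this; linarith
  have hl := left_mem_Icc.2 ht₀.2
  have hr := right_mem_Icc.2 ht₀.2
  exact ⟨t₀, t₁, ht₀.1, ht₀.2, ht₁.2, le_antisymm ha (hat _ hl), le_antisymm (hbt _ hr) hb,
    fun t ht => ⟨hat t ht, hbt t ht⟩⟩

/-- An absolutely continuous function that climbs from below `a` to above `b` and whose speed at
height `v` is at most `S v > 0` needs at least the time `∫ₐᵇ 1 / S`. -/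
theorem AbsolutelyContinuousOnInterval.integral_inv_speed_le {ζ S : ℝ → ℝ} {T a b : ℝ}
    (hT : 0 ≤ T) (hab : a < b) (hζ : AbsolutelyContinuousOnInterval ζ 0 T)
    (h0 : ζ 0 ≤ a) (h1 : b ≤ ζ T) (hS : ContinuousOn S (Icc a b)) (hpos : ∀ v ∈ Icc a b, 0 < S v)
    (hd : ∀ᵐ t, t ∈ Icc 0 T → ζ t ∈ Icc a b → ∃ d ≤ S (ζ t), HasDerivAt ζ d t) :
    ∫ v in a..b, 1 / S v ≤ T := by
  have hc := hζ.continuousOn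
  rw [uIcc_of_le hT] at hc
  obtain ⟨t₀, t₁, ht₀, ht, ht₁, ha, hb, hm⟩ := hc.exists_crossing hT hab h0 h1
  have hI : ContinuousOn (fun v => 1 / S v) (Icc a b) :=
    continuousOn_const.div hS fun v hv => (hpos v hv).ne'
  -- Constant extension of `1 / S` makes the primitive `G` of class `C¹` on all of `ℝ`, so the chain
  -- rule for `G ∘ ζ` holds also at the heights `a` and `b`.
  set g : ℝ → ℝ := IccExtend hab.le ((Icc a b).domRestrict fun v => 1 / S v) with hg
  have hgc : Continuous g := (continuousOn_iff_continuous_domRestrict.1 hI).Icc_extend'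
  have hgv : ∀ v ∈ Icc a b, g v = 1 / S v := fun v hv => by
    rw [hg, IccExtend_of_mem _ _ hv]; rfl
  set G : ℝ → ℝ := fun v => ∫ w in a..v, g w
  have hG : ∀ v, HasDerivAt G (g v) v := fun v => hgc.integral_hasStrictDerivAt a v |>.hasDerivAt
  have hG1 : ContDiff ℝ 1 G := contDiff_one_iff_deriv.2
    ⟨fun v => (hG v).differentiableAt, by rwa [funext fun v => (hG v).deriv]⟩
  obtain ⟨K, hK⟩ := hG1.contDiffOn.exists_lipschitzOnWith one_ne_zero (convex_Icc a b) isCompact_Icc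
  have hsub : uIcc t₀ t₁ ⊆ uIcc 0 T := by
    rw [uIcc_of_le ht, uIcc_of_le hT]; exact Icc_subset_Icc ht₀ ht₁
  have hAC : AbsolutelyContinuousOnInterval (G ∘ ζ) t₀ t₁ :=
    hK.comp_absolutelyContinuousOnInterval (hζ.mono hsub) (by rw [uIcc_of_le ht]; exact hm)
  have := hAC.sub_le_of_ae_deriv_le (c := 1) ht <| by
    filter_upwards [hd] with t hdt htm
    have hmt := hm t (Ioc_subset_Icc_self htm)
    obtain ⟨d, hdS, hd⟩ := hdt ⟨ht₀.trans htm.1.le, htm.2.trans ht₁⟩ hmt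
    refine ⟨g (ζ t) * d, ?_, (hG _).comp t hd⟩
    rw [hgv _ hmt, one_div_mul_eq_div, div_le_one (hpos _ hmt)]
    exact hdS
  have hGb : G b = ∫ v in a..b, 1 / S v :=
    intervalIntegral.integral_congr fun v hv => hgv v (by rwa [uIcc_of_le hab.le] at hv)
  have hGa : G a = 0 := intervalIntegral.integral_same
  simp only [Function.comp, ha, hb, hGa, hGb] at this
  linarith

/-- Grönwall's argument, with `κ` of either sign: the derivative `(ζ' + κ ζ) exp (κ x)` of the
product is nonpositive. -/
theorem AbsolutelyContinuousOnInterval.mul_exp_le {ζ : ℝ → ℝ} {s t κ : ℝ} (hst : s ≤ t)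
    (hζ : AbsolutelyContinuousOnInterval ζ s t)
    (hd : ∀ᵐ x, x ∈ Ioc s t → ∃ d ≤ -κ * ζ x, HasDerivAt ζ d x) :
    ζ t * Real.exp (κ * t) ≤ ζ s * Real.exp (κ * s) := by
  have hE : AbsolutelyContinuousOnInterval (fun x => Real.exp (κ * x)) s t :=
    ContDiffOn.absolutelyContinuousOnInterval (ContDiff.contDiffOn (by fun_prop))
  have := (hζ.mul hE).sub_le_of_ae_deriv_le (c := 0) hst <| by
    filter_upwards [hd] with x hdx hx
    obtain ⟨d, hdκ, hd⟩ := hdx hx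
    refine ⟨_, ?_, hd.mul ((hasDerivAt_id x).const_mul κ |>.exp)⟩
    have := Real.exp_pos (κ * x)
    simp only [id, mul_one]
    nlinarith
  simp only [zero_mul, Pi.mul_apply] at this
  linarith

/-- An absolutely continuous function cannot climb past a height at which its maximal speed `S`,
Lipschitz in the height, is nonpositive. -/
theorem AbsolutelyContinuousOnInterval.false_of_speed_nonpos {ζ S : ℝ → ℝ} {T a b v : ℝ} {K : ℝ≥0}
    (hT : 0 ≤ T) (hab : a < b) (hζ : AbsolutelyContinuousOnInterval ζ 0 T)
    (h0 : ζ 0 ≤ a) (h1 : b ≤ ζ T) (hS : LipschitzOnWith K S (Icc a b)) (hv : v ∈ Icc a b)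
    (hSv : S v ≤ 0)
    (hd : ∀ᵐ t, t ∈ Icc 0 T → ζ t ∈ Icc a b → ∃ d ≤ S (ζ t), HasDerivAt ζ d t) : False := by
  have hc := hζ.continuousOn
  rw [uIcc_of_le hT] at hc
  have hSK : ∀ w ∈ Icc a b, S w ≤ K * |w - v| := fun w hw => by
    have := (le_abs_self _).trans (hS.dist_le_mul w hw v hv)
    rw [Real.dist_eq] at this
    linarith
  -- Above `v` this is used with `κ = -K`, below `v` with `κ = K`.
  have key : ∀ t₀ t₁ κ, 0 ≤ t₀ → t₀ ≤ t₁ → t₁ ≤ T →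
      (∀ t ∈ Icc t₀ t₁, ζ t ∈ Icc a b ∧ K * |ζ t - v| = -κ * (ζ t - v)) →
      (ζ t₁ - v) * Real.exp (κ * t₁) ≤ (ζ t₀ - v) * Real.exp (κ * t₀) := by
    intro t₀ t₁ κ ht₀ ht ht₁ hm
    have hsub : uIcc t₀ t₁ ⊆ uIcc 0 T := by
      rw [uIcc_of_le ht, uIcc_of_le hT]; exact Icc_subset_Icc ht₀ ht₁
    have hAC : AbsolutelyContinuousOnInterval (fun t => ζ t - v) t₀ t₁ :=
      (hζ.mono hsub).sub
        (LipschitzWith.const v).lipschitzOnWith.absolutelyContinuousOnInterval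
    refine hAC.mul_exp_le ht ?_
    filter_upwards [hd] with t hdt htm
    obtain ⟨hmt, hK⟩ := hm t (Ioc_subset_Icc_self htm)
    obtain ⟨d, hdS, hd⟩ := hdt ⟨ht₀.trans htm.1.le, htm.2.trans ht₁⟩ hmt
    exact ⟨d, hK ▸ hdS.trans (hSK _ hmt), hd.sub_const v⟩
  -- If `v < b`, the excess `ζ - v` cannot grow from zero to a positive value. If `v = b`, the
  -- deficit `b - ζ` shrinks at most exponentially and so cannot vanish.
  rcases hv.2.lt_or_eq with hvb | rfl
  · obtain ⟨t₀, t₁, ht₀, ht, ht₁, ha, hb, hm⟩ := hc.exists_crossing hT hvb (h0.trans hv.1) h1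
    have := key t₀ t₁ (-K) ht₀ ht ht₁ fun t ht => ⟨⟨hv.1.trans (hm t ht).1, (hm t ht).2⟩, by
      rw [abs_of_nonneg (sub_nonneg.2 (hm t ht).1), neg_neg]⟩
    rw [ha, hb, sub_self, zero_mul] at this
    exact absurd (mul_pos (sub_pos.2 hvb) (Real.exp_pos _)) this.not_gt
  · obtain ⟨t₀, t₁, ht₀, ht, ht₁, ha, hb, hm⟩ := hc.exists_crossing hT hab h0 h1
    have := key t₀ t₁ K ht₀ ht ht₁ fun t ht => ⟨hm t ht, by
      rw [abs_of_nonpos (sub_nonpos.2 (hm t ht).2), neg_mul, mul_neg]⟩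
    rw [ha, hb, sub_self, zero_mul] at this
    exact absurd (mul_neg_of_neg_of_pos (sub_neg.2 hab) (Real.exp_pos _)) this.not_gt

end Comparison

/-! ### Steering along curves whose height follows the drift. -/

section Steering

open Filter Topology

/-- The global bound `M` allows Picard–Lindelöf on a ball of radius `M * T`, hence on all of `[0,
T]`. Constant extension makes the solution Lipschitz on `ℝ`. -/
theorem exists_lipschitz_solution {g : ℝ → ℝ → ℝ} {K M : ℝ≥0} {T : ℝ} (hT : 0 ≤ T) (x₀ : ℝ)
    (hK : ∀ t, LipschitzWith K (g t)) (hc : ∀ x, Continuous fun t => g t x)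
    (hM : ∀ t x, |g t x| ≤ M) :
    ∃ α : ℝ → ℝ, α 0 = x₀ ∧ LipschitzWith M α ∧ ∀ t ∈ Ioo 0 T, HasDerivAt α (g t (α t)) t := by
  lift T to ℝ≥0 using hT
  have hT := T.coe_nonneg
  have hPL : IsPicardLindelof g (tmin := 0) (tmax := T) ⟨0, le_rfl, hT⟩ x₀ (M * T) 0 M K :=
    { lipschitzOnWith := fun t _ => (hK t).lipschitzOnWith
      continuousOn := fun x _ => (hc x).continuousOn
      norm_le := fun t _ x _ => hM t x
      mul_max_le := by simp }
  obtain ⟨β, hβ0, hβ⟩ := hPL.exists_eq_forall_mem_Icc_hasDerivWithinAt₀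
  have hβL : LipschitzOnWith M β (Icc 0 T) :=
    (convex_Icc _ _).lipschitzOnWith_of_nnnorm_hasDerivWithin_le hβ fun t _ => hM t _
  refine ⟨IccExtend hT ((Icc 0 (T : ℝ)).domRestrict β), ?_, ?_, fun t ht => ?_⟩
  · rw [IccExtend_of_mem _ _ ⟨le_rfl, hT⟩]
    exact hβ0
  · have := hβL.to_restrict.comp (LipschitzWith.projIcc hT)
    rwa [mul_one] at this
  · have hmem := Ioo_subset_Icc_self ht
    have hnhds := Icc_mem_nhds ht.1 ht.2
    rw [IccExtend_of_mem _ _ hmem]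
    refine ((hβ t hmem).hasDerivAt hnhds).congr_of_eventuallyEq ?_
    filter_upwards [hnhds] with s hs
    rw [IccExtend_of_mem _ _ hs]
    rfl

variable {E : Type*} [NormedAddCommGroup E] [InnerProductSpace ℝ E]

/-- A Lipschitz curve in `C` leads from `p` to `q` in time `T`, and its component in the direction
`e` moves with the speed prescribed by `f`, except at finitely many times. -/
def Steerable (e : E) (f : E → ℝ) (C : Set E) (T : ℝ) (p q : E) : Prop :=
  0 ≤ T ∧ ∃ (y : ℝ → E) (K : ℝ≥0) (N : Set ℝ), N.Finite ∧ LipschitzWith K y ∧ y 0 = p ∧ y T = q ∧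
    (∀ t ∈ Icc 0 T, y t ∈ C) ∧
    ∀ t ∈ Ioo 0 T, t ∉ N → HasDerivAt (fun s => inner ℝ e (y s)) (f (y t)) t

namespace Steerable

variable {e p q r : E} {f : E → ℝ} {C : Set E} {T T₁ T₂ : ℝ}

theorem refl (hp : p ∈ C) : Steerable e f C 0 p p :=
  ⟨le_rfl, fun _ => p, 0, ∅, finite_empty, LipschitzWith.const p, rfl, rfl, fun _ _ => hp,
    fun _ ht => absurd ht.1 ht.2.not_gt⟩

/-- Serves to end a route exactly at a given point: one starts there under the drift `-f` and runs
the curve backwards. -/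
theorem reverse (h : Steerable e f C T p q) : Steerable e (-f) C T q p := by
  obtain ⟨hT, y, K, N, hN, hy, h0, h1, hC, hd⟩ := h
  refine ⟨hT, fun t => y (T - t), K, (fun t => T - t) '' N, hN.image _, ?_, by simpa, by simpa,
    fun t ht => hC _ ⟨by linarith [ht.2], by linarith [ht.1]⟩, fun t ht htN => ?_⟩
  · have hs : LipschitzWith 1 fun t : ℝ => T - t := by
      refine LipschitzWith.of_dist_le_mul fun s t => ?_
      rw [dist_sub_left, NNReal.coe_one, one_mul]
    simpa [Function.comp_def] using hy.comp hs
  · have h := hd (T - t) ⟨by linarith [ht.2], by linarith [ht.1]⟩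
      fun hmem => htN ⟨_, hmem, by ring⟩
    have h2 : HasDerivAt (fun s : ℝ => T - s) (-1) t := by
      simpa using (hasDerivAt_id t).const_sub T
    simpa [Function.comp_def] using HasDerivAt.comp t h h2

theorem trans (h₁ : Steerable e f C T₁ p q) (h₂ : Steerable e f C T₂ q r) :
    Steerable e f C (T₁ + T₂) p r := by
  obtain ⟨hT₁, y₁, K₁, N₁, hN₁, hy₁, h10, h11, hC₁, hd₁⟩ := h₁
  obtain ⟨hT₂, y₂, K₂, N₂, hN₂, hy₂, h20, h21, hC₂, hd₂⟩ := h₂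
  -- At each time one of the first two terms equals `q`. Written as a sum, the concatenation is
  -- visibly Lipschitz.
  set y : ℝ → E := fun t => y₁ (min t T₁) + y₂ (max (t - T₁) 0) - q with hy
  have hl : ∀ t ≤ T₁, y t = y₁ t := fun t ht => by
    simp [hy, min_eq_left ht, max_eq_right (sub_nonpos.2 ht), h20]
  have hr : ∀ t, T₁ ≤ t → y t = y₂ (t - T₁) := fun t ht => by
    simp [hy, min_eq_right ht, max_eq_left (sub_nonneg.2 ht), h11]
  refine ⟨by positivity, y, K₁ + K₂, N₁ ∪ {T₁} ∪ (fun t => t + T₁) '' N₂,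
    (hN₁.union (finite_singleton _)).union (hN₂.image _), ?_, ?_, ?_, ?_, ?_⟩
  · have hm : LipschitzWith 1 fun t : ℝ => min t T₁ := LipschitzWith.id.min_const T₁
    have hs : LipschitzWith 1 fun t : ℝ => t - T₁ := by
      refine LipschitzWith.of_dist_le_mul fun s t => ?_
      simp [Real.dist_eq]
    have hM : LipschitzWith 1 fun t : ℝ => max (t - T₁) 0 := hs.max_const 0
    have := ((hy₁.comp hm).add (hy₂.comp hM)).sub (LipschitzWith.const q)
    simpa [Function.comp_def] using this
  · rw [hl 0 hT₁, h10]
  · rw [hr _ (by linarith), add_sub_cancel_left, h21]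
  · intro t ht
    rcases le_total t T₁ with h | h
    · rw [hl t h]
      exact hC₁ t ⟨ht.1, h⟩
    · rw [hr t h]
      exact hC₂ _ ⟨by linarith, by linarith [ht.2]⟩
  · intro t ht htN
    simp only [mem_union, mem_singleton_iff, mem_image, not_or, not_exists, not_and] at htN
    obtain ⟨⟨htN₁, hne⟩, htN₂⟩ := htN
    rcases lt_or_gt_of_ne hne with h | h
    · rw [hl t h.le]
      refine (hd₁ t ⟨ht.1, h⟩ htN₁).congr_of_eventuallyEq ?_
      filter_upwards [Iio_mem_nhds h] with s hs
      rw [hl s (le_of_lt hs)]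
    · rw [hr t h.le]
      have h2 : HasDerivAt (fun s : ℝ => s - T₁) 1 t := (hasDerivAt_id t).sub_const T₁
      have h1 := hd₂ (t - T₁) ⟨by linarith, by linarith [ht.2]⟩ fun hm => htN₂ _ hm (by ring)
      have h3 := HasDerivAt.comp t h1 h2
      rw [mul_one] at h3
      refine h3.congr_of_eventuallyEq ?_
      filter_upwards [Ioi_mem_nhds h] with s hs
      simp only [Function.comp]
      rw [hr s (le_of_lt hs)]

end Steerable

variable {e : E} {f : E → ℝ} {C : Set E} {L : ℝ≥0}

theorem inner_add_smul_unit (he : ‖e‖ = 1) (x : E) (s : ℝ) :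
    inner ℝ e (x + s • e) = inner ℝ e x + s := by
  rw [inner_add_right, real_inner_smul_right, real_inner_self_eq_norm_sq, he]
  ring

theorem lipschitzWith_comp_add_clamp_smul (he : ‖e‖ = 1) (hf : LipschitzWith L f) (x : E)
    (s₁ s₂ : ℝ) : LipschitzWith L fun a : ℝ => f (x + max s₁ (min a s₂) • e) := by
  have hm : LipschitzWith 1 fun a : ℝ => max s₁ (min a s₂) :=
    (LipschitzWith.id.min_const s₂).const_max s₁
  have hl : LipschitzWith 1 fun a : ℝ => x + a • e := by
    refine LipschitzWith.of_dist_le_mul fun a b => ?_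
    rw [dist_add_left, dist_eq_norm, ← sub_smul, norm_smul, he, Real.dist_eq]
    simp
  simpa [Function.comp_def] using hf.comp (hl.comp hm)

/-- Fast motion inside a slice: the drift moves the coordinate in direction `e` only a little. -/
theorem exists_steerable_jump (he : ‖e‖ = 1) (hf : LipschitzWith L f) (hC : Convex ℝ C) {p q : E}
    (hp : p ∈ interior C) (hq : q ∈ interior C) (hpq : inner ℝ e p = inner ℝ e q) {ε : ℝ}
    (hε : 0 < ε) : ∃ T ≤ ε, ∃ s : ℝ, |s| ≤ ε ∧ Steerable e f C T p (q + s • e) := by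
  have hseg : IsCompact (segment ℝ p q) := by
    rw [segment_eq_image_lineMap]
    exact isCompact_Icc.image AffineMap.lineMap_continuous
  obtain ⟨ρ₀, hρ₀, hthick⟩ := hseg.exists_cthickening_subset_open isOpen_interior
    (hC.interior.segment_subset hp hq)
  -- Tube radius: shifts of the segment by at most `ρ` along `e` stay in `interior C`. With `M`
  -- bounding `f` on these shifts, the duration `δ` is so short that the height drifts by at most `M
  -- * δ ≤ ρ`.
  set ρ := min ρ₀ ε with hρdef
  have hρ : 0 < ρ := lt_min hρ₀ hε
  obtain ⟨M, hM⟩ : ∃ M, ∀ x ∈ (fun z : E × ℝ => z.1 + z.2 • e) '' (segment ℝ p q ×ˢ Icc (-ρ) ρ),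
      ‖f x‖ ≤ M :=
    ((hseg.prod isCompact_Icc).image (by fun_prop)).exists_bound_of_continuousOn
      hf.continuous.continuousOn
  have hM0 : 0 ≤ M := (norm_nonneg _).trans
    (hM p ⟨(p, 0), ⟨left_mem_segment ℝ p q, by simp [hρ.le]⟩, by simp⟩)
  lift M to ℝ≥0 using hM0
  set δ := min ε (ρ / (M + 1))
  have hδ : 0 < δ := lt_min hε (by positivity)
  have hδM : M * δ ≤ ρ := by
    have : δ ≤ ρ / (M + 1) := min_le_right _ _
    rw [le_div_iff₀ (by positivity)] at this
    nlinarith [M.2]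
  set w : ℝ → E := fun t => AffineMap.lineMap p q (max 0 (min (t / δ) 1)) with hw
  have hwseg : ∀ t, w t ∈ segment ℝ p q := fun t => by
    rw [segment_eq_image_lineMap]
    exact ⟨_, ⟨le_max_left _ _, max_le zero_le_one (min_le_right _ _)⟩, rfl⟩
  obtain ⟨Kw, hwL⟩ : ∃ K, LipschitzWith K w := by
    have h1 : LipschitzWith (Real.nnabs δ⁻¹) fun t : ℝ => t / δ := by
      refine LipschitzWith.of_dist_le_mul fun a b => ?_
      rw [Real.dist_eq, Real.dist_eq, ← sub_div, abs_div, div_eq_inv_mul, Real.coe_nnabs, abs_inv]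
    exact ⟨_, (lipschitzWith_lineMap p q).comp ((h1.min_const 1).const_max 0)⟩
  have hwφ : ∀ t, inner ℝ e (w t) = inner ℝ e p := fun t => by
    simp only [hw, AffineMap.lineMap_apply, vsub_eq_sub, vadd_eq_add, inner_add_right,
      real_inner_smul_right, inner_sub_right, hpq]
    ring
  -- The clamp keeps the vector field bounded by `M`; it is inactive along the solution because `|α|
  -- ≤ ρ` on `[0, δ]`.
  obtain ⟨α, hα0, hαL, hα⟩ := exists_lipschitz_solution
    (g := fun t a => f (w t + max (-ρ) (min a ρ) • e)) hδ.le 0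
    (fun t => lipschitzWith_comp_add_clamp_smul he hf (w t) (-ρ) ρ)
    (fun x => by have := hwL.continuous; have := hf.continuous; fun_prop)
    (fun t x => hM _ ⟨(w t, max (-ρ) (min x ρ)), ⟨hwseg t, le_max_left _ _,
      max_le (by linarith) (min_le_right _ _)⟩, rfl⟩)
  have hαρ : ∀ t ∈ Icc 0 δ, |α t| ≤ ρ := fun t ht => by
    have := hαL.dist_le_mul t 0
    rw [hα0, Real.dist_0_eq_abs, Real.dist_0_eq_abs, abs_of_nonneg ht.1] at this
    exact this.trans ((mul_le_mul_of_nonneg_left ht.2 M.2).trans hδM)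
  have hαe : LipschitzWith M fun t => α t • e := by
    refine LipschitzWith.of_dist_le_mul fun a b => ?_
    rw [dist_eq_norm, ← sub_smul, norm_smul, he, mul_one, ← dist_eq_norm]
    exact hαL.dist_le_mul a b
  refine ⟨δ, min_le_left _ _, α δ, (hαρ δ ⟨hδ.le, le_rfl⟩).trans (min_le_right _ _), hδ.le,
    fun t => w t + α t • e, Kw + M, ∅, finite_empty, hwL.add hαe, by simp [hw, hα0],
    by simp [hw, hδ.ne'], fun t ht => ?_, fun t ht _ => ?_⟩
  · refine interior_subset (hthick (Metric.mem_cthickening_of_dist_le _ (w t) _ _ (hwseg t) ?_))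
    rw [dist_eq_norm, add_sub_cancel_left, norm_smul, he, mul_one]
    exact (hαρ t ht).trans (min_le_left _ _)
  · have h1 := hα t ht
    obtain ⟨hlo, hhi⟩ := abs_le.1 (hαρ t (Ioo_subset_Icc_self ht))
    rw [min_eq_left hhi, max_eq_right hlo] at h1
    simp only [inner_add_smul_unit he, hwφ]
    exact h1.const_add _

/-- On the line `c + s • e` the height equation is the autonomous equation `s' = f (c + s • e)`,
whose speed is at least `κ`. It is solved for the full time `(s₂ - s₁) / κ` and stopped when it
reaches `s₂`. -/
theorem exists_steerable_line (he : ‖e‖ = 1) (hf : LipschitzWith L f) {c : E} {s₁ s₂ κ : ℝ}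
    (hs : s₁ ≤ s₂) (hκ : 0 < κ) (hc : ∀ s ∈ Icc s₁ s₂, c + s • e ∈ C ∧ κ ≤ f (c + s • e)) :
    ∃ T ≤ (s₂ - s₁) / κ, Steerable e f C T (c + s₁ • e) (c + s₂ • e) := by
  have hcl : ∀ a : ℝ, max s₁ (min a s₂) ∈ Icc s₁ s₂ := fun a =>
    ⟨le_max_left _ _, max_le hs (min_le_right _ _)⟩
  obtain ⟨M, hM⟩ : ∃ M, ∀ s ∈ Icc s₁ s₂, ‖f (c + s • e)‖ ≤ M :=
    isCompact_Icc.exists_bound_of_continuousOn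
      (by have := hf.continuous; fun_prop : Continuous fun s : ℝ => f (c + s • e)).continuousOn
  have hM0 : 0 ≤ M := (norm_nonneg _).trans (hM s₁ ⟨le_rfl, hs⟩)
  lift M to ℝ≥0 using hM0
  set T₀ := (s₂ - s₁) / κ
  have hT₀ : 0 ≤ T₀ := div_nonneg (sub_nonneg.2 hs) hκ.le
  obtain ⟨α, hα0, hαL, hα⟩ := exists_lipschitz_solution
    (g := fun _ a => f (c + max s₁ (min a s₂) • e)) hT₀ s₁
    (fun t => lipschitzWith_comp_add_clamp_smul he hf c s₁ s₂)
    (fun x => continuous_const) (fun t x => hM _ (hcl x))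
  have hgrow : ∀ s ∈ Icc 0 T₀, ∀ t ∈ Icc 0 T₀, s ≤ t → κ * (t - s) ≤ α t - α s := by
    refine (convex_Icc 0 T₀).mul_sub_le_image_sub_of_le_deriv hαL.continuous.continuousOn ?_ ?_
    all_goals rw [interior_Icc]
    · exact fun t ht => (hα t ht).differentiableAt.differentiableWithinAt
    · intro t ht
      rw [(hα t ht).deriv]
      exact (hc _ (hcl _)).2
  have hend : s₂ ≤ α T₀ := by
    have := hgrow 0 ⟨le_rfl, hT₀⟩ T₀ ⟨hT₀, le_rfl⟩ hT₀
    rw [hα0, sub_zero, mul_div_cancel₀ _ hκ.ne'] at this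
    linarith
  obtain ⟨T, hT, hαT⟩ := intermediate_value_Icc hT₀ hαL.continuous.continuousOn
    (⟨hα0.le.trans hs, hend⟩ : s₂ ∈ Icc (α 0) (α T₀))
  have hαm : ∀ t ∈ Icc 0 T, α t ∈ Icc s₁ s₂ := fun t ht => by
    have htT : t ∈ Icc 0 T₀ := ⟨ht.1, ht.2.trans hT.2⟩
    have h1 := hgrow 0 ⟨le_rfl, hT₀⟩ t htT ht.1
    have h2 := hgrow t htT T hT ht.2
    have h3 := mul_nonneg hκ.le (sub_nonneg.2 ht.1)
    have h4 := mul_nonneg hκ.le (sub_nonneg.2 ht.2)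
    exact ⟨by linarith, by linarith⟩
  have hαe : LipschitzWith M fun t => α t • e := by
    refine LipschitzWith.of_dist_le_mul fun a b => ?_
    rw [dist_eq_norm, ← sub_smul, norm_smul, he, mul_one, ← dist_eq_norm]
    exact hαL.dist_le_mul a b
  refine ⟨T, hT.2, hT.1, fun t => c + α t • e, 0 + M, ∅, finite_empty,
    (LipschitzWith.const c).add hαe, by simp [hα0], by simp [hαT],
    fun t ht => (hc _ (hαm t ht)).1, fun t ht _ => ?_⟩
  have h1 := hα t ⟨ht.1, ht.2.trans_le hT.2⟩
  obtain ⟨hlo, hhi⟩ := hαm t (Ioo_subset_Icc_self ht)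
  rw [min_eq_left hhi, max_eq_right hlo] at h1
  simp only [inner_add_smul_unit he]
  exact h1.const_add _

/-- Three legs: a jump from `p` to the line through `c`, a run along that line at speed at least
`κ`, and a jump to `q`. The strict inequality for `τ` pays for the jumps. -/
theorem exists_steerable_near (he : ‖e‖ = 1) (hf : LipschitzWith L f) (hC : Convex ℝ C)
    {c p q : E} {η κ τ : ℝ} (hκ : 0 < κ) (hc : ∀ x ∈ Metric.ball c η, x ∈ C ∧ κ ≤ f x)
    (hp : p ∈ interior C) (hq : q ∈ interior C) (hpc : |inner ℝ e p - inner ℝ e c| < η)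
    (hqc : |inner ℝ e q - inner ℝ e c| < η) (hpq : inner ℝ e p < inner ℝ e q)
    (hτ : (inner ℝ e q - inner ℝ e p) / κ < τ) : ∃ T ≤ τ, Steerable e f C T p q := by
  set a := inner ℝ e p - inner ℝ e c with ha
  set b := inner ℝ e q - inner ℝ e c with hb
  have hab : inner ℝ e q - inner ℝ e p = b - a := by rw [ha, hb]; ring
  rw [hab] at hτ
  have hline : ∀ s : ℝ, |s| < η → c + s • e ∈ Metric.ball c η := fun s hs => by
    rwa [Metric.mem_ball, dist_eq_norm, add_sub_cancel_left, norm_smul, he, mul_one]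
  have hint : ∀ s : ℝ, |s| < η → c + s • e ∈ interior C := fun s hs =>
    interior_maximal (fun x hx => (hc x hx).1) Metric.isOpen_ball (hline s hs)
  have h1 : ∀ᶠ ε in 𝓝 (0 : ℝ), |a| + ε < η := by
    refine ContinuousAt.eventually_lt (by fun_prop) continuousAt_const (by simpa using hpc)
  have h2 : ∀ᶠ ε in 𝓝 (0 : ℝ), |b| + ε < η := by
    refine ContinuousAt.eventually_lt (by fun_prop) continuousAt_const (by simpa using hqc)
  have h3 : ∀ᶠ ε in 𝓝 (0 : ℝ), a + 2 * ε < b := by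
    refine ContinuousAt.eventually_lt (by fun_prop) continuousAt_const ?_
    linarith
  have h4 : ∀ᶠ ε in 𝓝 (0 : ℝ), ε + ((b - a + 2 * ε) / κ + ε) < τ := by
    refine ContinuousAt.eventually_lt (by fun_prop) continuousAt_const (by simpa using hτ)
  obtain ⟨ε, ⟨h1, h2, h3, h4⟩, hε⟩ := ((h1.and (h2.and (h3.and h4))).filter_mono
    nhdsWithin_le_nhds |>.and (self_mem_nhdsWithin (s := Ioi (0 : ℝ)))).exists
  obtain ⟨T₁, hT₁, s₁, hs₁, hst₁⟩ := exists_steerable_jump he hf hC hp (hint a hpc)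
    (by rw [inner_add_smul_unit he, ha]; ring) hε
  -- The last leg starts at `q` under `-f` and is then reversed, so that the height error falls on
  -- the line and not on the target.
  obtain ⟨T₃, hT₃, s₃, hs₃, hst₃⟩ := exists_steerable_jump he hf.neg hC hq (hint b hqc)
    (by rw [inner_add_smul_unit he, hb]; ring) hε
  have hst₃ := hst₃.reverse
  rw [add_assoc, ← add_smul] at hst₁ hst₃
  obtain ⟨hs₁l, hs₁r⟩ := abs_le.1 hs₁
  obtain ⟨hs₃l, hs₃r⟩ := abs_le.1 hs₃
  obtain ⟨hal, har⟩ := abs_lt.1 (lt_sub_iff_add_lt.2 h1)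
  obtain ⟨hbl, hbr⟩ := abs_lt.1 (lt_sub_iff_add_lt.2 h2)
  obtain ⟨T₂, hT₂, hst₂⟩ := exists_steerable_line (C := C) (s₁ := a + s₁) (s₂ := b + s₃) he hf
    (by linarith) hκ fun s hs => hc _ (hline s (abs_lt.2
      ⟨by linarith [hs.1], by linarith [hs.2]⟩))
  have hst₃' : Steerable e f C T₃ (c + (b + s₃) • e) q := by
    convert hst₃ using 1
    ext x
    simp
  refine ⟨T₁ + (T₂ + T₃), ?_, hst₁.trans (hst₂.trans hst₃')⟩
  have : (b + s₃ - (a + s₁)) / κ ≤ (b - a + 2 * ε) / κ := by gcongr; linarith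
  linarith

end Steering

/-! ### Regularity of the maximal speed, and nearly optimal steering. -/

section SliceSpeed

open Filter Topology

variable {E : Type*} [NormedAddCommGroup E] [InnerProductSpace ℝ E]

/-- The supremum of `f` over the part of `C` at height `v` in direction `e`. -/
noncomputable def sliceSpeed (e : E) (f : E → ℝ) (C : Set E) (v : ℝ) : ℝ :=
  sSup (f '' (C ∩ {x | inner ℝ e x = v}))

variable {e : E} {f : E → ℝ} {C : Set E} {L : ℝ≥0} {p q : E}

theorem bddAbove_image_slice (hf : LipschitzWith L f) (hCb : Bornology.IsBounded C) (v : ℝ) :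
    BddAbove (f '' (C ∩ {x | inner ℝ e x = v})) :=
  (hf.isBounded_image (hCb.subset inter_subset_left)).bddAbove

theorem le_sliceSpeed (hf : LipschitzWith L f) (hCb : Bornology.IsBounded C) {x : E} (hx : x ∈ C) :
    f x ≤ sliceSpeed e f C (inner ℝ e x) :=
  le_csSup (bddAbove_image_slice hf hCb _) ⟨x, ⟨hx, rfl⟩, rfl⟩

theorem inner_add_smul_sub (x z : E) (l : ℝ) :
    inner ℝ e (x + l • (z - x)) = inner ℝ e x + l * (inner ℝ e z - inner ℝ e x) := by
  rw [inner_add_right, real_inner_smul_right, inner_sub_right]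

/-- A point of the segment `[p, q]` at the height `v`. -/
theorem exists_interior_slice (hC : Convex ℝ C) (hp : p ∈ interior C) (hq : q ∈ interior C)
    (hpq : inner ℝ e p < inner ℝ e q) :
    ∃ P : ℝ → E, (∀ v ∈ Icc (inner ℝ e p) (inner ℝ e q), P v ∈ interior C ∧ inner ℝ e (P v) = v) ∧
      P (inner ℝ e p) = p ∧ P (inner ℝ e q) = q := by
  have hpos := sub_pos.2 hpq
  refine ⟨fun v => p + ((v - inner ℝ e p) / (inner ℝ e q - inner ℝ e p)) • (q - p),
    fun v hv => ⟨?_, ?_⟩, by simp, by simp [div_self hpos.ne']⟩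
  · exact hC.interior.add_smul_sub_mem hp hq ⟨div_nonneg (by linarith [hv.1]) hpos.le,
      (div_le_one hpos).2 (by linarith [hv.2])⟩
  · rw [inner_add_smul_sub, div_mul_cancel₀ _ hpos.ne']
    ring

theorem exists_beyond (he : ‖e‖ = 1) (hp : p ∈ interior C) :
    ∃ r > 0, ∀ s : ℝ, |s| ≤ r → p + s • e ∈ C := by
  obtain ⟨r, hr, hball⟩ := Metric.isOpen_iff.1 isOpen_interior p hp
  refine ⟨r / 2, half_pos hr, fun s hs => interior_subset (hball ?_)⟩
  rw [Metric.mem_ball, dist_eq_norm, add_sub_cancel_left, norm_smul, he, mul_one]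
  exact hs.trans_lt (half_lt_self hr)

/-- A point `x` of one slice is slid to height `v'` along a segment towards `q + r • e` or `p - r •
e`. These points of `C` lie beyond the ends, so their height differs from that of `x` by at least
`r`. Hence `x` moves by at most `2 * D / r` times the change of height, where `D` bounds the norm on
`C`. -/
theorem exists_lipschitzOnWith_sliceSpeed (he : ‖e‖ = 1) (hf : LipschitzWith L f)
    (hC : Convex ℝ C) (hCb : Bornology.IsBounded C) (hp : p ∈ interior C) (hq : q ∈ interior C)
    (hpq : inner ℝ e p < inner ℝ e q) :
    ∃ K, LipschitzOnWith K (sliceSpeed e f C) (Icc (inner ℝ e p) (inner ℝ e q)) := by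
  obtain ⟨r₀, hr₀, hp'⟩ := exists_beyond he hp
  obtain ⟨r₁, hr₁, hq'⟩ := exists_beyond he hq
  obtain ⟨D, hD⟩ := hCb.exists_norm_le
  have hD0 : 0 ≤ D := (norm_nonneg p).trans (hD p (interior_subset hp))
  obtain ⟨P, hP, -, -⟩ := exists_interior_slice hC hp hq hpq
  set r := min r₀ r₁
  have hr : 0 < r := lt_min hr₀ hr₁
  have move : ∀ x ∈ C, ∀ z ∈ C, ∀ v d, 0 ≤ d → r ≤ |inner ℝ e z - inner ℝ e x| →
      d * (inner ℝ e z - inner ℝ e x) = (v - inner ℝ e x) * |inner ℝ e z - inner ℝ e x| →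
      d ≤ |inner ℝ e z - inner ℝ e x| → f x ≤ sliceSpeed e f C v + L * (2 * D) / r * d := by
    intro x hx z hz v d hd0 hrw hdir hdw
    set w := |inner ℝ e z - inner ℝ e x|
    have hw : 0 < w := hr.trans_le hrw
    have hl0 : 0 ≤ d / w := div_nonneg hd0 hw.le
    have hmem : x + (d / w) • (z - x) ∈ C :=
      hC.add_smul_sub_mem hx hz ⟨hl0, (div_le_one hw).2 hdw⟩
    have hv : inner ℝ e (x + (d / w) • (z - x)) = v := by
      rw [inner_add_smul_sub, div_mul_eq_mul_div, hdir, mul_div_cancel_right₀ _ hw.ne']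
      ring
    have h1 := le_sliceSpeed (e := e) hf hCb hmem
    rw [hv] at h1
    have h2 := (le_abs_self _).trans (hf.dist_le_mul x (x + (d / w) • (z - x)))
    rw [dist_self_add_right, norm_smul, Real.norm_of_nonneg hl0] at h2
    have h3 : ‖z - x‖ ≤ 2 * D := (norm_sub_le z x).trans (by linarith [hD x hx, hD z hz])
    have h4 : d / w ≤ d / r := by gcongr
    have h5 : (L : ℝ) * (d / w * ‖z - x‖) ≤ L * (d / r * (2 * D)) := by
      gcongr
    have h6 : (L : ℝ) * (d / r * (2 * D)) = L * (2 * D) / r * d := by ring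
    linarith
  have hK0 : 0 ≤ L * (2 * D) / r := by positivity
  refine ⟨⟨_, hK0⟩, LipschitzOnWith.of_le_add_mul _ fun v hv v' hv' => ?_⟩
  refine csSup_le ⟨_, P v, ⟨interior_subset (hP v hv).1, (hP v hv).2⟩, rfl⟩ ?_
  rintro _ ⟨x, ⟨hx, rfl⟩, rfl⟩
  rw [Real.dist_eq]
  rcases le_total (inner ℝ e x) v' with h | h
  · have hz : inner ℝ e (q + r • e) - inner ℝ e x = inner ℝ e q - inner ℝ e x + r := by
      rw [inner_add_smul_unit he]; ring
    have h0 : 0 ≤ inner ℝ e q - inner ℝ e x + r := by linarith [hv.2]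
    refine move x hx (q + r • e) (hq' r ?_) v' _ (abs_nonneg _) ?_ ?_ ?_
    · rw [abs_of_pos hr]; exact min_le_right _ _
    · rw [hz, abs_of_nonneg h0]; linarith [hv.2]
    · rw [hz, abs_of_nonneg h0, abs_of_nonpos (by linarith)]; ring
    · rw [hz, abs_of_nonneg h0, abs_of_nonpos (by linarith)]; linarith [hv'.2]
  · have hz : inner ℝ e (p + (-r) • e) - inner ℝ e x = -(inner ℝ e x - inner ℝ e p + r) := by
      rw [inner_add_smul_unit he]; ring
    have h0 : 0 ≤ inner ℝ e x - inner ℝ e p + r := by linarith [hv.1]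
    refine move x hx (p + (-r) • e) (hp' (-r) ?_) v' _ (abs_nonneg _) ?_ ?_ ?_
    · rw [abs_neg, abs_of_pos hr]; exact min_le_left _ _
    · rw [hz, abs_neg, abs_of_nonneg h0]; linarith [hv.1]
    · rw [hz, abs_neg, abs_of_nonneg h0, abs_of_nonneg (by linarith)]; ring
    · rw [hz, abs_neg, abs_of_nonneg h0, abs_of_nonneg (by linarith)]; linarith [hv'.1]

/-- A near-maximiser may lie on the boundary. Pushing it slightly towards the interior point `p` of
the same slice costs little by continuity of `f`. -/
theorem exists_interior_lt_of_lt_sliceSpeed (hf : LipschitzWith L f) (hC : Convex ℝ C) {v κ : ℝ}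
    (hp : p ∈ interior C) (hpv : inner ℝ e p = v) (hκ : κ < sliceSpeed e f C v) :
    ∃ c ∈ interior C, inner ℝ e c = v ∧ κ < f c := by
  obtain ⟨_, ⟨x, ⟨hx, hxv⟩, rfl⟩, hfx⟩ := exists_lt_of_lt_csSup
    (⟨_, p, ⟨interior_subset hp, hpv⟩, rfl⟩ : (f '' (C ∩ {x | inner ℝ e x = v})).Nonempty) hκ
  have hev : ∀ᶠ l in 𝓝 (0 : ℝ), κ < f (x + l • (p - x)) := by
    have := hf.continuous
    exact ContinuousAt.eventually_lt continuousAt_const (by fun_prop) (by simpa using hfx)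
  obtain ⟨l, hl, hl01⟩ := (hev.filter_mono nhdsWithin_le_nhds |>.and
    (Ioc_mem_nhdsGT (zero_lt_one' ℝ))).exists
  refine ⟨_, hC.add_smul_sub_mem_interior hx hp hl01, ?_, hl⟩
  rw [inner_add_smul_sub, hpv, hxv]
  ring

/-- Steering from `p` to `q` takes hardly more time than moving at the maximal speed. -/
theorem exists_steerable_le_integral (he : ‖e‖ = 1) (hf : LipschitzWith L f) (hC : Convex ℝ C)
    (hCb : Bornology.IsBounded C) (hp : p ∈ interior C) (hq : q ∈ interior C)
    (hpq : inner ℝ e p < inner ℝ e q)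
    (hpos : ∀ v ∈ Icc (inner ℝ e p) (inner ℝ e q), 0 < sliceSpeed e f C v) {ε : ℝ} (hε : 0 < ε) :
    ∃ T ≤ ∫ v in (inner ℝ e p)..(inner ℝ e q), (1 / sliceSpeed e f C v + ε),
      Steerable e f C T p q := by
  obtain ⟨P, hP, hPp, hPq⟩ := exists_interior_slice hC hp hq hpq
  obtain ⟨K, hK⟩ := exists_lipschitzOnWith_sliceSpeed he hf hC hCb hp hq hpq
  set a : ℝ := inner ℝ e p
  set b : ℝ := inner ℝ e q
  set S := sliceSpeed e f C
  have hg : ContinuousOn (fun v => 1 / S v + ε) (Icc a b) :=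
    (continuousOn_const.div hK.continuousOn fun v hv => (hpos v hv).ne').add continuousOn_const
  have hgi : ∀ v ∈ Icc a b, ∀ w ∈ Icc a b,
      IntervalIntegrable (fun v => 1 / S v + ε) volume v w := fun v hv w hw =>
    (hg.mono (ordConnected_Icc.uIcc_subset hv hw)).intervalIntegrable
  have hloc : ∀ v : Icc a b, ∃ U : Set (Icc a b), IsOpen U ∧ v ∈ U ∧
      ∀ x ∈ U, ∀ y ∈ U, x < y → Icc x y ⊆ U →
        ∃ T ≤ ∫ w in (x : ℝ)..y, (1 / S w + ε), Steerable e f C T (P x) (P y) := by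
    rintro ⟨v, hv⟩
    have hSv := hpos v hv
    have hlt : ∀ᶠ κ in 𝓝 (S v), 1 / κ < 1 / S v + ε :=
      ContinuousAt.eventually_lt (continuousAt_const.div continuousAt_id hSv.ne')
        continuousAt_const (by simpa using hε)
    -- `κ < κ' < S v`: speed `κ'` is attained near `c`, and time is measured with `κ`. The gap
    -- between them absorbs the jumps, while `1 / κ < 1 / S + ε` persists near `v` and gives the
    -- integral bound.
    obtain ⟨κ, ⟨hκv, hκ0⟩, hκS⟩ := ((hlt.and (lt_mem_nhds hSv)).filter_mono
      nhdsWithin_le_nhds |>.and (self_mem_nhdsWithin (s := Iio (S v)))).exists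
    obtain ⟨κ', hκκ', hκ'S⟩ := exists_between (show κ < S v from hκS)
    obtain ⟨c, hcC, hcv, hfc⟩ := exists_interior_lt_of_lt_sliceSpeed hf hC
      (hP v hv).1 (hP v hv).2 hκ'S
    obtain ⟨η, hη, hball⟩ := Metric.isOpen_iff.1
      (isOpen_interior.inter (isOpen_Ioi.preimage hf.continuous) :
        IsOpen (interior C ∩ f ⁻¹' Ioi κ')) c ⟨hcC, hfc⟩
    obtain ⟨O, hO, hOeq⟩ := (continuousOn_iff'.1 hg) (Ioi (1 / κ)) isOpen_Ioi
    have hvO : v ∈ O := (hOeq.subset ⟨hκv, hv⟩).1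
    refine ⟨Subtype.val ⁻¹' (O ∩ Metric.ball v η),
      (hO.inter Metric.isOpen_ball).preimage continuous_subtype_val,
      ⟨hvO, Metric.mem_ball_self hη⟩, ?_⟩
    rintro ⟨x, hx⟩ hxU ⟨y, hy⟩ hyU hxy hsub
    replace hxy : x < y := hxy
    have hτ : (y - x) / κ ≤ ∫ w in x..y, (1 / S w + ε) := by
      have : ∫ w in x..y, 1 / κ ≤ ∫ w in x..y, (1 / S w + ε) := by
        refine intervalIntegral.integral_mono_on hxy.le (by simp) (hgi x hx y hy) fun w hw => ?_
        have hw' : w ∈ Icc a b := ⟨hx.1.trans hw.1, hw.2.trans hy.2⟩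
        have hwO : w ∈ O := (hsub (show (⟨w, hw'⟩ : Icc a b) ∈ Icc ⟨x, hx⟩ ⟨y, hy⟩ from hw)).1
        exact (hOeq.superset ⟨hwO, hw'⟩).1.le
      simpa [div_eq_mul_inv] using this
    obtain ⟨T, hT, hst⟩ := exists_steerable_near (τ := (y - x) / κ) he hf hC (hκ0.trans hκκ')
      (fun z hz => ⟨interior_subset (hball hz).1, (hball hz).2.le⟩) (hP x hx).1 (hP y hy).1
      (by rw [(hP x hx).2, hcv]; exact hxU.2) (by rw [(hP y hy).2, hcv]; exact hyU.2)
      (by rwa [(hP x hx).2, (hP y hy).2])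
      (by
        rw [(hP x hx).2, (hP y hy).2]
        exact div_lt_div_of_pos_left (sub_pos.2 hxy) hκ0 hκκ')
    exact ⟨T, hT.trans hτ, hst⟩
  choose U hUo hUv hU using hloc
  -- A partition of `[a, b]` subordinate to the cover; it is only weakly monotone, so consecutive
  -- nodes may coincide.
  obtain ⟨t, ht0, htm, ⟨m, hm⟩, htU⟩ := exists_monotone_Icc_subset_open_cover_Icc hpq.le hUo
    fun v _ => mem_iUnion.2 ⟨v, hUv v⟩
  have hchain : ∀ n, ∃ T ≤ ∫ w in a..(t n), (1 / S w + ε), Steerable e f C T p (P (t n)) := by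
    intro n
    induction n with
    | zero =>
      rw [ht0, hPp, intervalIntegral.integral_same]
      exact ⟨0, le_rfl, Steerable.refl (interior_subset hp)⟩
    | succ n ih =>
      obtain ⟨T, hT, hst⟩ := ih
      rcases (htm n.le_succ).lt_or_eq with hlt | heq
      · obtain ⟨i, hi⟩ := htU n
        obtain ⟨T', hT', hst'⟩ := hU i (t n) (hi ⟨le_rfl, hlt.le⟩) (t (n + 1)) (hi ⟨hlt.le, le_rfl⟩)
          hlt hi
        refine ⟨T + T', ?_, hst.trans hst'⟩
        rw [← intervalIntegral.integral_add_adjacent_intervals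
          (hgi a ⟨le_rfl, hpq.le⟩ _ (t n).2) (hgi _ (t n).2 _ (t (n + 1)).2)]
        exact add_le_add hT hT'
      · rw [← Nat.succ_eq_add_one, ← heq]
        exact ⟨T, hT, hst⟩
  have := hchain m
  rw [hm m le_rfl] at this
  rwa [hPq] at this

end SliceSpeed

/-! ### Translation between the control system, the inclusion and the height. -/

namespace ControlTime

open Filter Topology
open scoped Pointwise

variable {n m : ℕ} {F : State n → State n} {L : ℝ≥0} {B : Matrix (Fin n) (Fin m) ℝ}
  {C : Set (State n)} {e : slowSpace B}

theorem slowProj_range (w : State m) : slowProj B (Matrix.toEuclideanLin B w) = 0 :=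
  Submodule.orthogonalProjectionOnto_eq_zero_iff.2
    (Submodule.le_orthogonal_orthogonal _ ⟨w, rfl⟩)

theorem inner_slowProj (x : State n) : inner ℝ e (slowProj B x) = inner ℝ (e : State n) x :=
  Submodule.inner_orthogonalProjectionOnto_eq_of_mem_left e x

theorem eq_inner_smul (hH : Module.finrank ℝ (slowSpace B) = 1) (he : ‖e‖ = 1) (h : slowSpace B) :
    h = inner ℝ e h • e := by
  obtain ⟨c, rfl⟩ := (finrank_eq_one_iff_of_nonzero' e (norm_ne_zero_iff.1 (by simp [he]))).1 hH h
  rw [real_inner_smul_right, real_inner_self_eq_norm_sq, he]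
  simp

theorem mem_slice_iff (hH : Module.finrank ℝ (slowSpace B) = 1) (he : ‖e‖ = 1) {h : slowSpace B}
    {x : State n} : x ∈ slice B C h ↔ x ∈ C ∧ inner ℝ (e : State n) x = inner ℝ e h := by
  refine and_comm.trans (and_congr_right fun _ => ⟨?_, fun hx => ?_⟩)
  · rintro ⟨w, hw, rfl⟩
    rw [inner_add_right, Submodule.inner_right_of_mem_orthogonal e.2 hw, add_zero]
    rfl
  · have : slowProj B x = h := by
      rw [eq_inner_smul hH he h, ← hx, ← inner_slowProj, ← eq_inner_smul hH he]
    refine ⟨x - h, ?_, by simp⟩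
    rw [← this]
    exact Submodule.sub_starProjection_mem_orthogonal x

theorem lipschitzWith_inner_unit (hF : LipschitzWith L F) (he : ‖e‖ = 1) :
    LipschitzWith L fun x => inner ℝ (e : State n) (F x) := by
  refine LipschitzWith.of_dist_le_mul fun x y => ?_
  rw [Real.dist_eq, ← inner_sub_right]
  refine (abs_real_inner_le_norm _ _).trans ?_
  rw [← Submodule.coe_norm, he, one_mul, ← dist_eq_norm]
  exact hF.dist_le_mul x y

/-- Here `⟪x, h1 - h0⟫ = ‖h1 - h0‖ * ⟪e, x⟫`, and the factor leaves the supremum and cancels. -/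
theorem maxSpeed_eq_sliceSpeed (hH : Module.finrank ℝ (slowSpace B) = 1) {h0 h1 : slowSpace B}
    (hne : h0 ≠ h1) (he : e = ‖h1 - h0‖⁻¹ • (h1 - h0)) (he1 : ‖e‖ = 1) (h : slowSpace B) :
    maxSpeed F B C h h0 h1 =
      sliceSpeed (e : State n) (fun x => inner ℝ (e : State n) (F x)) C (inner ℝ e h) := by
  have hl : ‖h1 - h0‖ ≠ 0 := norm_ne_zero_iff.2 (sub_ne_zero.2 hne.symm)
  have hdir : h1 - h0 = ‖h1 - h0‖ • e := by rw [he, smul_inv_smul₀ hl]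
  have himg : (fun x : slowSpace B => inner ℝ x (h1 - h0)) '' (slowDrift F B '' slice B C h) =
      ‖h1 - h0‖ • ((fun x => inner ℝ (e : State n) (F x)) ''
        (C ∩ {x | inner ℝ (e : State n) x = inner ℝ e h})) := by
    have hs : slice B C h = C ∩ {x | inner ℝ (e : State n) x = inner ℝ e h} :=
      Set.ext fun x => mem_slice_iff hH he1
    rw [hs, image_image, ← image_smul, image_image]
    refine image_congr fun x _ => ?_
    rw [real_inner_comm, smul_eq_mul, ← inner_slowProj, slowDrift, ← real_inner_smul_left, ← hdir]
  rw [maxSpeed, himg, Real.sSup_smul_of_nonneg (norm_nonneg _), smul_eq_mul,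
    mul_div_cancel_left₀ _ hl]
  rfl

/-- A linear right inverse of `B` on its range, which is `Hᗮ`. Its continuity makes the controls
built from it measurable and bounded. -/
theorem exists_range_section (B : Matrix (Fin n) (Fin m) ℝ) :
    ∃ G : State n →L[ℝ] State m,
      ∀ x ∈ (slowSpace B)ᗮ, Matrix.toEuclideanLin B (G x) = x := by
  obtain ⟨g, hg⟩ := (Matrix.toEuclideanLin B).rangeRestrict.exists_rightInverse_of_surjective
    (LinearMap.range_rangeRestrict _)
  refine ⟨(g ∘ₗ (LinearMap.range
    (Matrix.toEuclideanLin B)).orthogonalProjectionOnto.toLinearMap).toContinuousLinearMap,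
    fun x hx => ?_⟩
  rw [Submodule.orthogonal_orthogonal] at hx
  have h1 := congrArg Subtype.val (LinearMap.congr_fun hg ⟨x, hx⟩)
  have h2 : (LinearMap.range (Matrix.toEuclideanLin B)).orthogonalProjectionOnto x = ⟨x, hx⟩ :=
    Submodule.orthogonalProjectionOnto_mem_subspace_eq_self
      (⟨x, hx⟩ : LinearMap.range (Matrix.toEuclideanLin B))
  simp only [LinearMap.coe_toContinuousLinearMap', LinearMap.comp_apply,
    ContinuousLinearMap.coe_coe, h2]
  exact h1

/-- The height equation says that `y' - F(y)` is orthogonal to `e`, hence to `H`, so it lies in the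
range of `B`. The control is its preimage under the section, bounded because `y` is Lipschitz. -/
theorem exists_isControlledTrajectory (hF : LipschitzWith L F)
    (hH : Module.finrank ℝ (slowSpace B) = 1) (he : ‖e‖ = 1) {T : ℝ} {p q : State n}
    (h : Steerable (e : State n) (fun x => inner ℝ (e : State n) (F x)) C T p q) :
    ∃ u y, IsControlledTrajectory F B C T u y ∧ y 0 = p ∧ y T = q := by
  obtain ⟨hT, y, K, N, hN, hy, h0, h1, hC, hd⟩ := h
  obtain ⟨G, hG⟩ := exists_range_section B
  have hFy : Continuous fun t => F (y t) := hF.continuous.comp hy.continuous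
  refine ⟨fun t => G (deriv y t - F (y t)), y, ⟨?_, ?_, ?_, hC⟩, h0, h1⟩
  · obtain ⟨M, hM⟩ := isCompact_Icc.exists_bound_of_continuousOn (s := Icc 0 T) hFy.continuousOn
    refine MemLp.of_bound ?_ (‖G‖ * (K + M)) ?_
    · exact (G.continuous.measurable.comp
        ((measurable_deriv y).sub hFy.measurable)).aestronglyMeasurable
    · filter_upwards [ae_restrict_mem measurableSet_Icc] with t ht
      refine G.le_opNorm_of_le ((norm_sub_le _ _).trans (add_le_add ?_ (hM t ht)))
      exact norm_deriv_le_of_lipschitz hy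
  · exact hy.lipschitzOnWith.absolutelyContinuousOnInterval
  · rw [ae_restrict_iff' measurableSet_Icc]
    filter_upwards [hy.ae_differentiableAt_real, hN.countable.ae_notMem volume,
      (countable_singleton (0 : ℝ)).ae_notMem volume, (countable_singleton T).ae_notMem volume]
      with t hdt htN ht0 htT ht
    have htI : t ∈ Ioo 0 T := ⟨lt_of_le_of_ne ht.1 (Ne.symm ht0), lt_of_le_of_ne ht.2 htT⟩
    have hmem : deriv y t - F (y t) ∈ (slowSpace B)ᗮ := by
      rw [Submodule.mem_orthogonal]
      intro w hw
      have h3 := (hasDerivAt_const t (e : State n)).inner ℝ hdt.hasDerivAt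
      have h4 := h3.unique (hd t htI htN)
      rw [inner_zero_left, add_zero] at h4
      have hw' := congrArg Subtype.val (eq_inner_smul hH he ⟨w, hw⟩)
      simp only [Submodule.coe_smul] at hw'
      rw [hw', real_inner_smul_left, inner_sub_right, h4, sub_self, mul_zero]
    rw [hG _ hmem, add_sub_cancel]
    exact hdt.hasDerivAt

theorem IsControlledTrajectory.isInclusionTrajectory {T : ℝ} {u : ℝ → State m} {y : ℝ → State n}
    (h : IsControlledTrajectory F B C T u y) :
    IsInclusionTrajectory F B C T fun t => slowProj B (y t) where
  absCont := ((slowProj B).lipschitz.lipschitzOnWith (s := univ)).comp_absolutelyContinuousOnInterval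
    h.absCont (mapsTo_univ _ _)
  inclusion := by
    filter_upwards [h.ode, ae_restrict_mem measurableSet_Icc] with t hd ht
    refine ⟨_, ⟨y t, ⟨⟨y t - slowProj B (y t),
      Submodule.sub_starProjection_mem_orthogonal _, by simp⟩, h.constraint t ht⟩, rfl⟩, ?_⟩
    have := (slowProj B).hasFDerivAt.comp_hasDerivAt t hd
    rwa [map_add, slowProj_range, add_zero] at this

theorem auxControlTime_le_controlTime (y0 y1 : State n) :
    auxControlTime F B C y0 y1 ≤ controlTime F B C y0 y1 := by
  refine sInf_le_sInf ?_
  rintro τ ⟨T, hT, rfl, u, y, h, rfl, rfl⟩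
  exact ⟨T, hT.le, rfl, _, h.isInclusionTrajectory, rfl, rfl⟩

/-- The height of an inclusion trajectory in direction `e` grows at most with the slice speed. -/
theorem IsInclusionTrajectory.absolutelyContinuous_height (hF : LipschitzWith L F)
    (hH : Module.finrank ℝ (slowSpace B) = 1) (he : ‖e‖ = 1) (hCb : Bornology.IsBounded C)
    {T : ℝ} {z : ℝ → slowSpace B} (h : IsInclusionTrajectory F B C T z) :
    AbsolutelyContinuousOnInterval (fun t => inner ℝ e (z t)) 0 T ∧
    ∀ᵐ t, t ∈ Icc 0 T → ∃ d ≤ sliceSpeed (e : State n) (fun x => inner ℝ (e : State n) (F x)) C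
      (inner ℝ e (z t)), HasDerivAt (fun t => inner ℝ e (z t)) d t := by
  constructor
  · exact ((innerSL ℝ e).lipschitz.lipschitzOnWith (s := univ)).comp_absolutelyContinuousOnInterval
      h.absCont (mapsTo_univ _ _)
  · filter_upwards [(ae_restrict_iff' measurableSet_Icc).1 h.inclusion] with t hi ht
    obtain ⟨_, ⟨x, hx, rfl⟩, hd⟩ := hi ht
    rw [mem_slice_iff hH he] at hx
    have h1 := le_sliceSpeed (e := (e : State n)) (lipschitzWith_inner_unit hF he) hCb hx.1
    rw [hx.2] at h1
    refine ⟨_, h1, ?_⟩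
    have h3 := (hasDerivAt_const t e).inner ℝ hd
    rwa [inner_zero_left, add_zero, slowDrift, inner_slowProj] at h3

end ControlTime

/-! ### The formula for the controllability time. -/

open ControlTime in
theorem mainTheorem1 {n m : ℕ}
    (F : State n → State n) (L : ℝ≥0) (hF : LipschitzWith L F)
    (B : Matrix (Fin n) (Fin m) ℝ) (hB : B.rank = m)
    (hH : Module.finrank ℝ (slowSpace B) = 1)
    (C : Set (State n)) (hCb : Bornology.IsBounded C) (hCc : Convex ℝ C)
    (y0 y1 : State n) (hy0 : y0 ∈ interior C) (hy1 : y1 ∈ interior C)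
    (h0 h1 : slowSpace B) (hh0 : h0 = slowProj B y0) (hh1 : h1 = slowProj B y1)
    (hne : h0 ≠ h1) :
    ((∀ h ∈ segment ℝ h0 h1, 0 < maxSpeed F B C h h0 h1) →
      controlTime F B C y0 y1 = auxControlTime F B C y0 y1 ∧
      controlTime F B C y0 y1 < ∞ ∧
      IntervalIntegrable (fun v => 1 / maxSpeed F B C (arcPoint h0 h1 v) h0 h1)
        volume 0 ‖h1 - h0‖ ∧
      controlTime F B C y0 y1 =
        ENNReal.ofReal
          (∫ v in (0 : ℝ)..‖h1 - h0‖, 1 / maxSpeed F B C (arcPoint h0 h1 v) h0 h1)) ∧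
    ((∃ h2 ∈ segment ℝ h0 h1, maxSpeed F B C h2 h0 h1 ≤ 0) →
      controlTime F B C y0 y1 = ∞ ∧ auxControlTime F B C y0 y1 = ∞) := by
  have hl : 0 < ‖h1 - h0‖ := norm_pos_iff.2 (sub_ne_zero.2 hne.symm)
  obtain ⟨e, he⟩ : ∃ e : slowSpace B, e = ‖h1 - h0‖⁻¹ • (h1 - h0) := ⟨_, rfl⟩
  have he1 : ‖e‖ = 1 := by
    rw [he, norm_smul, norm_inv, norm_norm, inv_mul_cancel₀ hl.ne']
  have hdir : h1 - h0 = ‖h1 - h0‖ • e := by rw [he, smul_inv_smul₀ hl.ne']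
  have hen : ‖(e : State n)‖ = 1 := he1
  have hspeed := maxSpeed_eq_sliceSpeed (F := F) (C := C) hH hne he he1
  have hfL := lipschitzWith_inner_unit hF he1
  have hi0 : inner ℝ e h0 = inner ℝ (e : State n) y0 := by rw [hh0, inner_slowProj]
  have hi1 : inner ℝ e h1 = inner ℝ (e : State n) y1 := by rw [hh1, inner_slowProj]
  have hie : inner ℝ e e = 1 := by rw [real_inner_self_eq_norm_sq, he1, one_pow]
  have hil : inner ℝ (e : State n) y1 = inner ℝ (e : State n) y0 + ‖h1 - h0‖ := by
    have := congrArg (inner ℝ e) hdir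
    rw [inner_sub_right, real_inner_smul_right, hi0, hi1, hie] at this
    linarith
  have harc : ∀ v, inner ℝ e (arcPoint h0 h1 v) = inner ℝ (e : State n) y0 + v := fun v => by
    rw [arcPoint, inner_add_right, real_inner_smul_right, inner_sub_right, hi0, hi1, hil]
    field_simp
    ring
  have hab : inner ℝ (e : State n) y0 < inner ℝ (e : State n) y1 := by linarith
  obtain ⟨K, hK⟩ := exists_lipschitzOnWith_sliceSpeed hen hfL hCc hCb hy0 hy1 hab
  set S := sliceSpeed (e : State n) (fun x => inner ℝ (e : State n) (F x)) C
  set a := inner ℝ (e : State n) y0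
  set b := inner ℝ (e : State n) y1
  refine ⟨fun hpos => ?_, ?_⟩
  · have hposS : ∀ v ∈ Icc a b, 0 < S v := fun v hv => by
      have := hpos (arcPoint h0 h1 (v - a)) ?_
      · rwa [hspeed, harc, add_sub_cancel] at this
      · rw [segment_eq_image']
        exact ⟨(v - a) / ‖h1 - h0‖, ⟨div_nonneg (sub_nonneg.2 hv.1) hl.le,
          (div_le_one hl).2 (by linarith [hv.2])⟩, rfl⟩
    have hfun : (fun v => 1 / maxSpeed F B C (arcPoint h0 h1 v) h0 h1) = fun v => 1 / S (a + v) :=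
      funext fun v => by rw [hspeed, harc]
    have hcont : ContinuousOn (fun v => 1 / S v) (Icc a b) :=
      continuousOn_const.div hK.continuousOn fun v hv => (hposS v hv).ne'
    have hint : IntervalIntegrable (fun v => 1 / S v) volume a b :=
      ContinuousOn.intervalIntegrable (by rwa [uIcc_of_le hab.le])
    have hshift : ∫ v in (0 : ℝ)..‖h1 - h0‖, 1 / S (a + v) = ∫ v in a..b, 1 / S v := by
      rw [intervalIntegral.integral_comp_add_left (fun v => 1 / S v), add_zero, ← hil]
    have hlow : ENNReal.ofReal (∫ v in a..b, 1 / S v) ≤ auxControlTime F B C y0 y1 := by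
      refine le_sInf ?_
      rintro τ ⟨T, hT, rfl, z, hz, hz0, hz1⟩
      obtain ⟨hAC, hd⟩ := hz.absolutelyContinuous_height hF hH he1 hCb
      refine ENNReal.ofReal_le_ofReal (hAC.integral_inv_speed_le hT hab ?_ ?_ hK.continuousOn
        hposS (hd.mono fun t ht htT _ => ht htT))
      · rw [hz0, inner_slowProj]
      · rw [hz1, inner_slowProj]
    have hup : controlTime F B C y0 y1 ≤ ENNReal.ofReal (∫ v in a..b, 1 / S v) := by
      refine ENNReal.le_of_forall_pos_le_add fun ε hε _ => ?_
      have hba := sub_pos.2 hab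
      -- The excess `ε / (b - a)` per unit of height integrates to `ε`.
      obtain ⟨T, hT, hst⟩ := exists_steerable_le_integral hen hfL hCc hCb hy0 hy1 hab hposS
        (ε := ε / (b - a)) (by positivity)
      obtain ⟨u, y, hy, hyt0, hyt1⟩ := exists_isControlledTrajectory hF hH he1 hst
      -- `controlTime` admits only positive times; `T = 0` would force `y0 = y1`, against `h0 ≠ h1`.
      have hT0 : 0 < T := hst.1.lt_of_ne fun h => by
        rw [← h, hyt0] at hyt1
        exact hne (by rw [hh0, hh1, hyt1])
      rw [intervalIntegral.integral_add hint (by simp), intervalIntegral.integral_const,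
        smul_eq_mul, mul_div_cancel₀ _ hba.ne'] at hT
      have hTle : controlTime F B C y0 y1 ≤ ENNReal.ofReal T :=
        sInf_le ⟨T, hT0, rfl, u, y, hy, hyt0, hyt1⟩
      refine hTle.trans ((ENNReal.ofReal_le_ofReal hT).trans (ENNReal.ofReal_add_le.trans ?_))
      rw [ENNReal.ofReal_coe_nnreal]
    have hle := auxControlTime_le_controlTime (F := F) (B := B) (C := C) y0 y1
    rw [hfun, hshift]
    refine ⟨le_antisymm (hup.trans hlow) hle, hup.trans_lt ENNReal.ofReal_lt_top, ?_,
      le_antisymm hup (hlow.trans hle)⟩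
    have := hint.comp_add_left a
    rwa [sub_self, hil, add_sub_cancel_left] at this
  · rintro ⟨h2, hh2, hs2⟩
    rw [hspeed] at hs2
    have hm : inner ℝ e h2 ∈ Icc a b := by
      obtain ⟨θ, ⟨hθ0, hθ1⟩, rfl⟩ := (segment_eq_image' ℝ h0 h1).subset hh2
      beta_reduce
      rw [hdir, smul_smul, inner_add_right, real_inner_smul_right, hie, hi0]
      constructor <;> nlinarith
    have htop : auxControlTime F B C y0 y1 = ∞ := by
      refine sInf_eq_top.2 ?_
      rintro τ ⟨T, hT, rfl, z, hz, hz0, hz1⟩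
      obtain ⟨hAC, hd⟩ := hz.absolutelyContinuous_height hF hH he1 hCb
      refine (hAC.false_of_speed_nonpos hT hab ?_ ?_ hK hm hs2
        (hd.mono fun t ht htT _ => ht htT)).elim
      · rw [hz0, inner_slowProj]
      · rw [hz1, inner_slowProj]
    exact ⟨top_le_iff.1 (htop ▸ auxControlTime_le_controlTime y0 y1), htop⟩
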